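/- All graphs are finite and simple; $\alpha(G)$ is the independence number and $\chi(G)$ the chromatic number of $G$, and $C_k$ is the cycle on $k$ vertices. A graph $G$ contains a graph $H$ as an immersion if there are an injective map $\phi\colon V(H)\to V(G)$ and, for every edge $uv\in E(H)$, a path $P_{uv}$ in $G$ with endpoints $\phi(u)$ and $\phi(v)$, such that the paths $P_{uv}$, $uv\in E(H)$, are pairwise edge disjoint and no vertex of $\phi(V(H))$ is an interior vertex of any of these paths. Theorem. Let $G$ be a graph with $\alpha(G)\ge 2$ such that, for every integer $k$ with $4\le k\le 2\alpha(G)$, $G$ has no induced subgraph isomorphic to $C_k$. Then $G$ contains the complete graph $K_{\chi(G)}$ as an immersion. -/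

import Mathlib

namespace SimpleGraph

/-- An immersion of `H` in `G` (in the strong sense): an injection of the vertices of `H` into those
of `G`, together with one path of `G` for each edge of `H`, joining the images of the ends of that
edge, such that the paths are pairwise edge disjoint and no branch vertex is an interior vertex of
any of the paths. The path of the edge `uv` is given with both of its orientations, from `u` to `v`
and from `v` to `u`; `path_symm` says that these are the same path. -/
structure Immersion {W V : Type*} (H : SimpleGraph W) (G : SimpleGraph V) where
  /-- The map to the branch vertices. -/
  branch : W ↪ V
  /-- The path for the edge `uv`. -/
  path : ∀ {u v : W}, H.Adj u v → G.Walk (branch u) (branch v)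
  path_symm : ∀ {u v : W} (h : H.Adj u v), path h.symm = (path h).reverse
  isPath : ∀ {u v : W} (h : H.Adj u v), (path h).IsPath
  edge_disjoint : ∀ {u v u' v' : W} (h : H.Adj u v) (h' : H.Adj u' v'), s(u, v) ≠ s(u', v') →
    List.Disjoint (path h).edges (path h').edges
  branch_not_interior : ∀ {u v : W} (h : H.Adj u v) (w : W),
    branch w ∈ (path h).support → branch w = branch u ∨ branch w = branch v

/-- `G` contains `H` as an immersion. -/
def ContainsImmersion {V W : Type*} (G : SimpleGraph V) (H : SimpleGraph W) : Prop :=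
  Nonempty (Immersion H G)

/-- `G` is finitely colourable and contains the complete graph on `χ(G)` vertices as an
immersion. -/
def SatisfiesLescureMeyniel {V : Type*} (G : SimpleGraph V) : Prop :=
  ∃ n : ℕ, G.chromaticNumber = n ∧ G.ContainsImmersion (completeGraph (Fin n))

end SimpleGraph

/-! Write `a` for the independence number and `t` for the chromatic number. If `G` has no hole at
all it is chordal, so simplicial elimination colours it with `cliqueNum` colours
(`colorable_cliqueNum_of_no_hole`), and a clique on `t` vertices is the immersion.

Otherwise every hole has length exactly `2 * a + 1`: shorter ones are excluded and longer ones
contain `a + 1` independent vertices. Relative to such a hole, every vertex either sees all of it or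
behaves like one of its vertices (`IsHole.isFull_or_isCenter`). Hence `G` is an odd cycle blown up
by cliques, joined to a clique (`IsHole.exists_isCycleInflation`).

Let `N` be the size of the common clique and `n j` that of class `j`, rotated so that class `0` is
smallest. If two consecutive classes and the common clique have at least `t` vertices together, they
form a large enough clique. If not, put `k = t - N - n 0 - n 1`. An even class `i ≥ 2` with fewer
than `k` vertices would give a colouring with `t - 1` colours (`IsCycleInflation.colorable`), so all
these classes have at least `k`. Then the common clique, classes `0` and `1`, and `k` vertices of
class `2` are branch vertices. Only pairs between classes `0` and `2` are non-adjacent; they are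
routed the long way round, where even classes have room for `k` numbers and odd ones for `n 0`
(`IsCycleInflation.containsImmersion_of_routing`). -/

namespace SimpleGraph

variable {V : Type*} {G : SimpleGraph V}

/-! ### Building complete immersions from walks -/

/-- A complete immersion from a set of branch vertices and walks whose edge sets are separated by
a family of sets of edges indexed by pairs of branch vertices. -/
theorem containsImmersion_completeGraph_of_walks (S : Finset V) (F : V → V → Set (Sym2 V))
    (hsymm : ∀ x y, F x y = F y x)
    (hwalk : ∀ x ∈ S, ∀ y ∈ S, x ≠ y → ∃ w : G.Walk x y, (∀ e ∈ w.edges, e ∈ F x y) ∧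
      ∀ z ∈ w.support, z ∈ S → z = x ∨ z = y)
    (hdisj : ∀ x ∈ S, ∀ y ∈ S, ∀ x' ∈ S, ∀ y' ∈ S, x ≠ y → x' ≠ y' →
      ∀ e, e ∈ F x y → e ∈ F x' y' → s(x, y) = s(x', y')) :
    G.ContainsImmersion (completeGraph (Fin S.card)) := by
  classical
  set b : Fin S.card ↪ V :=
    (S.equivFin.symm.toEmbedding.trans (Function.Embedding.subtype _)) with hb
  have hbS : ∀ i, b i ∈ S := fun i => (S.equivFin.symm i).2
  have hex : ∀ u v : Fin S.card, u ≠ v → ∃ w : G.Walk (b u) (b v), w.IsPath ∧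
      (∀ e ∈ w.edges, e ∈ F (b u) (b v)) ∧
      ∀ z ∈ w.support, z ∈ S → z = b u ∨ z = b v := by
    intro u v huv
    obtain ⟨w, h1, h2⟩ := hwalk (b u) (hbS u) (b v) (hbS v) (b.injective.ne huv)
    exact ⟨w.bypass, w.bypass_isPath, fun e he => h1 e (w.edges_bypass_subset_edges he),
      fun z hz => h2 z (w.support_bypass_subset_support hz)⟩
  choose P hP hPF hPS using hex
  -- The paths chosen for `(u, v)` and `(v, u)` may be unrelated; keeping the one with `u < v` and
  -- reversing it makes `path_symm` hold.
  let Q : ∀ {u v : Fin S.card}, (completeGraph (Fin S.card)).Adj u v → G.Walk (b u) (b v) :=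
    fun {u v} h => if u < v then P u v h.ne else (P v u h.ne').reverse
  have hQF : ∀ {u v} (h : (completeGraph (Fin S.card)).Adj u v), ∀ e ∈ (Q h).edges,
      e ∈ F (b u) (b v) := by
    intro u v h e he
    simp only [Q] at he
    split_ifs at he
    · exact hPF _ _ _ _ he
    · rw [hsymm]
      exact hPF _ _ _ _ (by simpa using he)
  refine ⟨⟨b, Q, ?_, ?_, ?_, ?_⟩⟩
  · intro u v h
    rcases lt_or_gt_of_ne h.ne with h' | h'
    · simp [Q, h', h'.not_gt]
    · simp [Q, h', h'.not_gt]
  · intro u v h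
    simp only [Q]
    split_ifs
    · exact hP _ _ _
    · exact (hP _ _ _).reverse
  · intro u v u' v' h h' hne e he he'
    refine hne ?_
    have := hdisj _ (hbS u) _ (hbS v) _ (hbS u') _ (hbS v') (b.injective.ne h.ne)
      (b.injective.ne h'.ne) e (hQF h e he) (hQF h' e he')
    have h2 : Sym2.map b s(u, v) = Sym2.map b s(u', v') := by simpa using this
    exact Sym2.map.injective b.injective h2
  · intro u v h w hw
    simp only [Q] at hw
    split_ifs at hw
    · exact hPS _ _ _ _ hw (hbS w)
    · exact (hPS _ _ _ _ (by simpa using hw) (hbS w)).symm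

theorem IsClique.containsImmersion {S : Finset V} (hS : G.IsClique S) :
    G.ContainsImmersion (completeGraph (Fin S.card)) := by
  refine containsImmersion_completeGraph_of_walks S (fun x y => {s(x, y)}) ?_ ?_ ?_
  · intro x y
    simp [Sym2.eq_swap]
  · intro x hx y hy hxy
    exact ⟨(hS hx hy hxy).toWalk, by simp, by simp⟩
  · intro x _ y _ x' _ y' _ _ _ e he he'
    simp only [Set.mem_singleton_iff] at he he'
    rw [← he, ← he']

/-- A sequence of consecutively adjacent vertices gives a walk. -/
theorem exists_walk_of_adj_succ (q : ℕ → V) (a : ℕ) : ∀ n : ℕ,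
    (∀ m, a ≤ m → m < a + n → G.Adj (q m) (q (m + 1))) →
    ∃ w : G.Walk (q a) (q (a + n)),
      (∀ e ∈ w.edges, ∃ m, a ≤ m ∧ m < a + n ∧ e = s(q m, q (m + 1))) ∧
      ∀ z ∈ w.support, ∃ m, a ≤ m ∧ m ≤ a + n ∧ z = q m := by
  intro n
  induction n with
  | zero => exact fun _ => ⟨.nil, by simp, by simpa using ⟨a, le_rfl, le_rfl, rfl⟩⟩
  | succ n ih =>
    intro h
    obtain ⟨w, h1, h2⟩ := ih fun m h1 h2 => h m h1 (by omega)
    refine ⟨w.concat (h (a + n) (by omega) (by omega)), ?_, ?_⟩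
    · intro e he
      rw [Walk.edges_concat, List.concat_eq_append, List.mem_append] at he
      rcases he with he | he
      · obtain ⟨m, h3, h4, h5⟩ := h1 e he
        exact ⟨m, h3, by omega, h5⟩
      · exact ⟨a + n, by omega, by omega, List.mem_singleton.1 he⟩
    · intro z hz
      rw [Walk.support_concat, List.mem_append] at hz
      rcases hz with hz | hz
      · obtain ⟨m, h3, h4, h5⟩ := h2 z hz
        exact ⟨m, h3, by omega, h5⟩
      · exact ⟨a + n + 1, by omega, by omega, List.mem_singleton.1 hz⟩

/-! ### Recognising induced cycles and induced paths -/

theorem cycleGraph_adj_iff_val {n : ℕ} (hn : 2 ≤ n) {u v : Fin n} :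
    (cycleGraph n).Adj u v ↔ u.val + 1 = v.val ∨ v.val + 1 = u.val ∨
      (u.val = 0 ∧ v.val + 1 = n) ∨ (v.val = 0 ∧ u.val + 1 = n) := by
  rw [cycleGraph_adj']
  have hu := u.2
  have hv := v.2
  have key : ∀ x y : Fin n, (x - y).val = 1 ↔ (y.val + 1 = x.val ∨ (x.val = 0 ∧ y.val + 1 = n)) := by
    intro x y
    have hx := x.2
    have hy := y.2
    rw [Fin.val_sub]
    rcases lt_or_ge x.val y.val with h | h
    · rw [Nat.mod_eq_of_lt (by omega)]; omega
    · rw [show n - y.val + x.val = n + (x.val - y.val) by omega, Nat.add_mod_left,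
        Nat.mod_eq_of_lt (by omega)]
      omega
  rw [key, key]
  tauto

/-- An induced path together with a vertex adjacent exactly to its two ends is an induced cycle. -/
theorem cycleGraph_isIndContained_of_path (q : ℕ → V) (r : V) (m : ℕ) (hm : 1 ≤ m)
    (hinj : ∀ i j, i < j → j ≤ m → q i ≠ q j)
    (hadj : ∀ i j, i < j → j ≤ m → (G.Adj (q i) (q j) ↔ j = i + 1))
    (hr : ∀ i ≤ m, r ≠ q i) (hra : ∀ i ≤ m, (G.Adj r (q i) ↔ i = 0 ∨ i = m)) :
    (cycleGraph (m + 2)).IsIndContained G := by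
  have hq : ∀ i j, i ≤ m → j ≤ m → q i = q j → i = j := by
    intro i j hi hj h
    rcases lt_trichotomy i j with h' | h' | h'
    · exact absurd h (hinj _ _ h' hj)
    · exact h'
    · exact absurd h.symm (hinj _ _ h' hi)
  have hqa : ∀ i j, i ≤ m → j ≤ m → (G.Adj (q i) (q j) ↔ j = i + 1 ∨ i = j + 1) := by
    intro i j hi hj
    rcases lt_trichotomy i j with h' | h' | h'
    · rw [hadj _ _ h' hj]; omega
    · subst h'; simp
    · rw [G.adj_comm, hadj _ _ h' hi]; omega
  refine ⟨⟨⟨fun i => if i.val ≤ m then q i.val else r, ?_⟩, ?_⟩⟩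
  · intro i j hij
    have hi := i.2
    have hj := j.2
    ext
    by_cases h1 : i.val ≤ m <;> by_cases h2 : j.val ≤ m <;> simp only [h1, h2, if_true, if_false] at hij
    · exact hq _ _ h1 h2 hij
    · exact absurd hij.symm (hr _ h1)
    · exact absurd hij (hr _ h2)
    · omega
  · intro i j
    have hi := i.2
    have hj := j.2
    rw [cycleGraph_adj_iff_val (by omega)]
    change G.Adj (if i.val ≤ m then q i.val else r) (if j.val ≤ m then q j.val else r) ↔ _
    by_cases h1 : i.val ≤ m <;> by_cases h2 : j.val ≤ m <;> simp only [h1, h2, if_true, if_false]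
    · rw [hqa _ _ h1 h2]; omega
    · rw [G.adj_comm, hra _ h1]; omega
    · rw [hra _ h2]; omega
    · simp only [G.irrefl, false_iff]; omega

/-- An induced four-cycle `a b c d`. -/
theorem cycleGraph_four_isIndContained {a b c d : V} (hab : G.Adj a b) (hbc : G.Adj b c)
    (hcd : G.Adj c d) (hda : G.Adj d a) (hac : ¬ G.Adj a c) (hbd : ¬ G.Adj b d) (hac' : a ≠ c)
    (hbd' : b ≠ d) : (cycleGraph 4).IsIndContained G := by
  refine cycleGraph_isIndContained_of_path (fun i => if i = 0 then a else if i = 1 then b else c) d 2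
    (by omega) ?_ ?_ ?_ ?_
  · intro i j hij hj
    interval_cases j <;> interval_cases i <;> simp [hab.ne, hac', hbc.ne]
  · intro i j hij hj
    interval_cases j <;> interval_cases i <;> simp [hab, hac, hbc]
  · intro i hi
    interval_cases i <;> simp [hda.ne, hcd.ne', hbd'.symm]
  · intro i hi
    rw [G.adj_comm] at hbd
    interval_cases i <;> simp [hda, hcd.symm, hbd]

/-- Two non-adjacent vertices joined by a walk inside a set are joined by an induced path in it. -/
theorem exists_induced_path_of_walk {s t : V} (hst : ¬ G.Adj s t) (hne : s ≠ t) (X : Set V)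
    (w : G.Walk s t) (hw : ∀ z ∈ w.support, z ∈ X) :
    ∃ (q : ℕ → V) (m : ℕ), 2 ≤ m ∧ q 0 = s ∧ q m = t ∧ (∀ i ≤ m, q i ∈ X) ∧
      (∀ i j, i < j → j ≤ m → q i ≠ q j) ∧
      ∀ i j, i < j → j ≤ m → (G.Adj (q i) (q j) ↔ j = i + 1) := by
  classical
  let Pr : ℕ → Prop := fun m => ∃ q : ℕ → V, q 0 = s ∧ q m = t ∧ (∀ i ≤ m, q i ∈ X) ∧
    ∀ i < m, G.Adj (q i) (q (i + 1))
  have hex : ∃ m, Pr m := ⟨w.length, w.getVert, by simp, by simp,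
    fun i _ => hw _ (w.getVert_mem_support i), fun i hi => w.adj_getVert_succ hi⟩
  -- A shortest sequence is induced: a repetition or a chord would allow the segment between its two
  -- positions to be cut out.
  set m := Nat.find hex
  obtain ⟨q, q0, qm, qX, qa⟩ : Pr m := Nat.find_spec hex
  have hmin : ∀ m' < m, ¬ Pr m' := fun m' h => Nat.find_min hex h
  have hinj : ∀ i j, i < j → j ≤ m → q i ≠ q j := by
    intro i j hij hj h
    refine hmin (m - (j - i)) (by omega) ⟨fun l => if l ≤ i then q l else q (l + (j - i)),
      by simp [q0], ?_, ?_, ?_⟩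
    · dsimp only
      split_ifs with h1
      · have : m = j := by omega
        rw [show m - (j - i) = i by omega, h, ← this, qm]
      · rw [show m - (j - i) + (j - i) = m by omega, qm]
    · intro l hl
      dsimp only
      split_ifs with h1
      · exact qX _ (by omega)
      · exact qX _ (by omega)
    · intro l hl
      dsimp only
      rcases lt_trichotomy l i with h1 | h1 | h1
      · rw [if_pos h1.le, if_pos (by omega)]; exact qa _ (by omega)
      · subst h1
        rw [if_pos le_rfl, if_neg (by omega), h, show l + 1 + (j - l) = j + 1 by omega]
        exact qa _ (by omega)
      · rw [if_neg (by omega), if_neg (by omega), show l + 1 + (j - i) = l + (j - i) + 1 by omega]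
        exact qa _ (by omega)
  have hadj : ∀ i j, i < j → j ≤ m → (G.Adj (q i) (q j) ↔ j = i + 1) := by
    intro i j hij hj
    refine ⟨fun h => ?_, fun h => h ▸ qa i (by omega)⟩
    by_contra hne'
    refine hmin (m - (j - i - 1)) (by omega) ⟨fun l => if l ≤ i then q l else q (l + (j - i - 1)),
      by simp [q0], ?_, ?_, ?_⟩
    · dsimp only
      rw [if_neg (by omega), show m - (j - i - 1) + (j - i - 1) = m by omega, qm]
    · intro l hl
      dsimp only
      split_ifs with h1
      · exact qX _ (by omega)
      · exact qX _ (by omega)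
    · intro l hl
      dsimp only
      rcases lt_trichotomy l i with h1 | h1 | h1
      · rw [if_pos h1.le, if_pos (by omega)]; exact qa _ (by omega)
      · subst h1
        rw [if_pos le_rfl, if_neg (by omega), show l + 1 + (j - l - 1) = j by omega]
        exact h
      · rw [if_neg (by omega), if_neg (by omega),
          show l + 1 + (j - i - 1) = l + (j - i - 1) + 1 by omega]
        exact qa _ (by omega)
  refine ⟨q, m, ?_, q0, qm, qX, hinj, hadj⟩
  by_contra hlt
  have : m = 0 ∨ m = 1 := by omega
  rcases this with h | h
  · rw [h, q0] at qm; exact hne qm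
  · apply hst
    rw [← q0, ← qm, h]
    exact qa 0 (by omega)

/-! ### Chordal graphs: simplicial vertices and colouring -/

/-- Dirac: a nonempty finite set of vertices of a graph without holes contains a vertex which is
simplicial in it. -/
theorem exists_simplicial_of_no_hole
    (hG : ∀ k, 4 ≤ k → ¬ (cycleGraph k).IsIndContained G) :
    ∀ (n : ℕ) (W : Finset V), W.card = n → W.Nonempty →
      ∃ v ∈ W, ∀ x ∈ W, ∀ y ∈ W, G.Adj v x → G.Adj v y → x ≠ y → G.Adj x y := by
  classical
  intro n
  induction n using Nat.strong_induction_on with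
  | _ n ih =>
  intro W hWn hW
  by_cases hcomplete : ∀ x ∈ W, ∀ y ∈ W, x ≠ y → G.Adj x y
  · obtain ⟨v, hv⟩ := hW
    exact ⟨v, hv, fun x hx y hy _ _ hxy => hcomplete x hx y hy hxy⟩
  push Not at hcomplete
  obtain ⟨a, ha, b, hb, hab, hnab⟩ := hcomplete
  -- `R C` is the part of `W` away from `C`. A largest connected `C` with `R C` nonempty is taken,
  -- and the simplicial vertex is found in `R C` by induction.
  let R : Finset V → Finset V := fun C => W.filter fun r => r ∉ C ∧ ∀ x ∈ C, ¬ G.Adj r x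
  let good : Finset V → Prop := fun C => C.Nonempty ∧ (R C).Nonempty ∧
    ∀ x ∈ C, ∀ y ∈ C, ∃ w : G.Walk x y, ∀ z ∈ w.support, z ∈ C
  have hgood : ((W.powerset).filter good).Nonempty := by
    refine ⟨{a}, ?_⟩
    simp only [Finset.mem_filter, Finset.mem_powerset, Finset.singleton_subset_iff]
    refine ⟨ha, Finset.singleton_nonempty a, ⟨b, ?_⟩, ?_⟩
    · simp only [R, Finset.mem_filter, Finset.mem_singleton, forall_eq]
      exact ⟨hb, hab.symm, fun h => hnab h.symm⟩
    · simp only [Finset.mem_singleton, forall_eq]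
      exact ⟨.nil, by simp⟩
  obtain ⟨C, hC, hmax⟩ := Finset.exists_max_image _ Finset.card hgood
  simp only [Finset.mem_filter, Finset.mem_powerset] at hC hmax
  obtain ⟨hCW, ⟨c0, hc0⟩, hRne, hconn⟩ := hC
  -- If `s` missed some `r` in `R C`, then `insert s C` would still be connected and leave `r` away
  -- from it, against maximality.
  have hcompl : ∀ s ∈ W, s ∉ C → (∃ x ∈ C, G.Adj s x) → ∀ r ∈ R C, G.Adj r s := by
    rintro s hs hsC ⟨x, hx, hsx⟩ r hr
    by_contra hrs
    have := hmax (insert s C) ⟨Finset.insert_subset hs hCW, Finset.insert_nonempty _ _, ⟨r, ?_⟩, ?_⟩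
    · rw [Finset.card_insert_of_notMem hsC] at this
      omega
    · simp only [R, Finset.mem_filter] at hr
      simp only [R, Finset.mem_filter, Finset.mem_insert, not_or, forall_eq_or_imp]
      refine ⟨hr.1, ⟨?_, hr.2.1⟩, hrs, hr.2.2⟩
      rintro rfl
      exact hr.2.2 x hx hsx
    · have hsy : ∀ y ∈ C, ∃ w : G.Walk s y, ∀ z ∈ w.support, z ∈ insert s C := by
        intro y hy
        obtain ⟨w, hw⟩ := hconn x hx y hy
        refine ⟨Walk.cons hsx w, ?_⟩
        simp only [Walk.support_cons, List.mem_cons, Finset.mem_insert]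
        exact fun z hz => hz.imp_right (hw z)
      intro y hy y' hy'
      rw [Finset.mem_insert] at hy hy'
      rcases hy with rfl | hy <;> rcases hy' with rfl | hy'
      · exact ⟨.nil, by simp⟩
      · exact hsy _ hy'
      · obtain ⟨w, hw⟩ := hsy _ hy
        exact ⟨w.reverse, by simpa using hw⟩
      · obtain ⟨w, hw⟩ := hconn y hy y' hy'
        exact ⟨w, fun z hz => Finset.mem_insert_of_mem (hw z hz)⟩
  have hRW : R C ⊆ W := Finset.filter_subset _ _
  have hlt : (R C).card < n := by
    rw [← hWn]
    refine Finset.card_lt_card ⟨hRW, fun h => ?_⟩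
    have := h (hCW hc0)
    simp only [R, Finset.mem_filter] at this
    exact this.2.1 hc0
  obtain ⟨v, hv, hsimp⟩ := ih _ hlt (R C) rfl hRne
  have hvC : ∀ x ∈ W, G.Adj v x → x ∈ R C ∨ (x ∉ C ∧ ∃ c ∈ C, G.Adj x c) := by
    intro x hx hvx
    have hv' := hv
    simp only [R, Finset.mem_filter] at hv' ⊢
    have : x ∉ C := fun h => hv'.2.2 x h hvx
    by_cases h : ∃ c ∈ C, G.Adj x c
    · exact .inr ⟨this, h⟩
    · push Not at h
      exact .inl ⟨hx, this, h⟩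
  refine ⟨v, hRW hv, fun x hx y hy hvx hvy hxy => ?_⟩
  rcases hvC x hx hvx with hx1 | ⟨hxC, hx1⟩ <;> rcases hvC y hy hvy with hy1 | ⟨hyC, hy1⟩
  · exact hsimp x hx1 y hy1 hvx hvy hxy
  · exact hcompl y hy hyC hy1 x hx1
  · exact (hcompl x hx hxC hx1 y hy1).symm
  -- Both `x` and `y` attach to `C`, so an induced path joins them through `C`; `v` has no neighbour
  -- in `C` and closes it to a hole.
  · by_contra hnxy
    obtain ⟨c, hc, hxc⟩ := hx1
    obtain ⟨d, hd, hyd⟩ := hy1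
    obtain ⟨w, hw⟩ := hconn c hc d hd
    obtain ⟨q, m, hm, q0, qm, qX, hinj, hadj⟩ := exists_induced_path_of_walk hnxy hxy
      {z | z = x ∨ z = y ∨ z ∈ C} ((Walk.cons hxc w).concat hyd.symm) (by
        intro z hz
        simp only [Walk.support_concat, Walk.support_cons,
          List.mem_append, List.mem_cons, List.not_mem_nil, or_false] at hz
        rcases hz with (h | h) | h
        · exact .inl h
        · exact .inr (.inr (hw z h))
        · exact .inr (.inl h))
    have hv' := hv
    simp only [R, Finset.mem_filter] at hv'
    refine hG (m + 2) (by omega) (cycleGraph_isIndContained_of_path q v m (by omega) hinj hadj ?_ ?_)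
    · intro i hi h
      rcases qX i hi with h1 | h1 | h1
      · exact hvx.ne (h.trans h1)
      · exact hvy.ne (h.trans h1)
      · exact hv'.2.1 (h ▸ h1)
    · intro i hi
      constructor
      · intro h
        rcases qX i hi with h1 | h1 | h1
        · left
          by_contra h0
          exact hinj 0 i (by omega) hi (q0.trans h1.symm)
        · right
          by_contra h0
          exact hinj i m (by omega) le_rfl (h1.trans qm.symm)
        · exact absurd h (hv'.2.2 _ h1)
      · rintro (rfl | rfl)
        · rwa [q0]
        · rwa [qm]

/-- Remove a simplicial vertex, colour the rest, and put it back: with its remaining neighbours it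
forms a clique, so they block fewer than `cliqueNum` colours. -/
theorem colorable_cliqueNum_of_no_hole [Finite V]
    (hG : ∀ k, 4 ≤ k → ¬ (cycleGraph k).IsIndContained G) : G.Colorable G.cliqueNum := by
  classical
  have := Fintype.ofFinite V
  suffices H : ∀ (n : ℕ) (W : Finset V), W.card = n → ∃ f : V → ℕ, (∀ v ∈ W, f v < G.cliqueNum) ∧
      ∀ u ∈ W, ∀ v ∈ W, G.Adj u v → f u ≠ f v by
    obtain ⟨f, h1, h2⟩ := H _ Finset.univ rfl
    exact ⟨Coloring.mk (fun v => (⟨f v, h1 v (Finset.mem_univ v)⟩ : Fin _)) (by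
      intro u v huv h
      exact h2 u (Finset.mem_univ _) v (Finset.mem_univ _) huv (by simpa using h))⟩
  intro n
  induction n with
  | zero =>
    intro W hW
    rw [Finset.card_eq_zero] at hW
    exact ⟨fun _ => 0, by simp [hW], by simp [hW]⟩
  | succ n ih =>
    intro W hW
    obtain ⟨v, hv, hs⟩ := exists_simplicial_of_no_hole hG _ W rfl
      (Finset.card_pos.1 (by omega))
    obtain ⟨f, h1, h2⟩ := ih (W.erase v) (by rw [Finset.card_erase_of_mem hv]; omega)
    set N := (W.erase v).filter (G.Adj v) with hN
    have hcl : G.IsClique (insert v N : Finset V) := by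
      intro x hx y hy hxy
      simp only [hN, Finset.coe_insert, Set.mem_insert_iff, Finset.mem_coe, Finset.mem_filter,
        Finset.mem_erase] at hx hy
      rcases hx with rfl | ⟨⟨_, hx⟩, hvx⟩ <;> rcases hy with rfl | ⟨⟨_, hy⟩, hvy⟩
      · exact absurd rfl hxy
      · exact hvy
      · exact hvx.symm
      · exact hs x hx y hy hvx hvy hxy
    have hcard : N.card + 1 ≤ G.cliqueNum := by
      have := IsClique.card_le_cliqueNum (tc := hcl)
      rwa [Finset.card_insert_of_notMem (by simp [hN])] at this
    obtain ⟨c, hc, hcN⟩ : ∃ c ∈ Finset.range G.cliqueNum, c ∉ N.image f := by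
      apply Finset.exists_mem_notMem_of_card_lt_card
      have := Finset.card_image_le (s := N) (f := f)
      rw [Finset.card_range]
      omega
    have hne : ∀ u ∈ W, G.Adj v u → f u ≠ c := by
      intro u hu hvu h
      refine hcN (Finset.mem_image.2 ⟨u, ?_, h⟩)
      simp [hN, hu, hvu, hvu.ne']
    refine ⟨Function.update f v c, ?_, ?_⟩
    · intro u hu
      by_cases huv : u = v
      · subst huv
        simpa using hc
      · rw [Function.update_of_ne huv]
        exact h1 u (by simp [hu, huv])
    · intro x hx y hy hxy
      by_cases hxv : x = v
      · subst hxv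
        rw [Function.update_self, Function.update_of_ne hxy.ne']
        exact (hne y hy hxy).symm
      · rw [Function.update_of_ne hxv]
        by_cases hyv : y = v
        · subst hyv
          rw [Function.update_self]
          exact hne x hx hxy.symm
        · rw [Function.update_of_ne hyv]
          exact h2 x (by simp [hx, hxv]) y (by simp [hy, hyv]) hxy

/-! ### Traces of vertices on a hole of length `2 * a + 1` -/

/-- An induced cycle, as a map from `ZMod n`. -/
structure IsHole {n : ℕ} (G : SimpleGraph V) (c : ZMod n → V) : Prop where
  injective : Function.Injective c
  adj_iff : ∀ i j, G.Adj (c i) (c j) ↔ j = i + 1 ∨ i = j + 1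

/-- The trace of `v` on the hole `c` consists of `c i` and its two neighbours; a vertex of the hole
counts as its own neighbour. -/
def IsCenter {n : ℕ} (G : SimpleGraph V) (c : ZMod n → V) (v : V) (i : ZMod n) : Prop :=
  ∀ j, (v = c j ∨ G.Adj v (c j)) ↔ (j = i - 1 ∨ j = i ∨ j = i + 1)

/-- The vertex `v` is adjacent to every vertex of the hole `c`. -/
def IsFull {n : ℕ} (G : SimpleGraph V) (c : ZMod n → V) (v : V) : Prop :=
  ∀ j, G.Adj v (c j)

theorem _root_.ZMod.natCast_inj_of_lt {n x y : ℕ} (hx : x < n) (hy : y < n) :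
    ((x : ZMod n) = y ↔ x = y) := by
  rw [ZMod.natCast_eq_natCast_iff', Nat.mod_eq_of_lt hx, Nat.mod_eq_of_lt hy]

theorem _root_.ZMod.small_ne_zero {n : ℕ} (hn : 5 ≤ n) : (1 : ZMod n) ≠ 0 ∧ (2 : ZMod n) ≠ 0 ∧
    (3 : ZMod n) ≠ 0 ∧ (4 : ZMod n) ≠ 0 := by
  have h : ∀ k : ℕ, 0 < k → k ≤ 4 → (k : ZMod n) ≠ 0 := by
    intro k hk hk4 h
    have := (ZMod.natCast_inj_of_lt (n := n) (x := k) (y := 0) (by omega) (by omega)).1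
      (by simpa using h)
    omega
  exact ⟨by simpa using h 1, by simpa using h 2, by simpa using h 3, by simpa using h 4⟩

section

variable {a : ℕ} {c : ZMod (2 * a + 1) → V}

/-- Every other vertex of the hole gives `a` independent vertices; if `v` missed them all, it would
be an independent `(a + 1)`-th. -/
theorem IsHole.exists_adj_alternate (hc : G.IsHole c)
    (hind : ∀ S : Finset V, G.IsIndepSet S → S.card ≤ a) {v : V} (hv : ∀ j, v ≠ c j)
    (i : ZMod (2 * a + 1)) : ∃ m < a, G.Adj v (c (i + ((2 * m + 1 : ℕ) : ZMod (2 * a + 1)))) := by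
  classical
  by_contra! hno
  set g : ℕ → V := fun m => c (i + ((2 * m + 1 : ℕ) : ZMod (2 * a + 1))) with hg
  have hginj : Set.InjOn g (Finset.range a : Finset ℕ) := by
    intro x hx y hy hxy
    simp only [Finset.coe_range, Set.mem_Iio] at hx hy
    have := (ZMod.natCast_inj_of_lt (by omega) (by omega)).1 (add_left_cancel (hc.injective hxy))
    omega
  have hgadj : ∀ x < a, ∀ y < a, ¬ G.Adj (g x) (g y) := by
    intro x hx y hy h
    have key : ∀ x < a, ∀ y < a, i + ((2 * y + 1 : ℕ) : ZMod (2 * a + 1)) ≠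
        i + ((2 * x + 1 : ℕ) : ZMod (2 * a + 1)) + 1 := by
      intro x hx y hy h
      rw [add_assoc] at h
      have h1 := add_left_cancel h
      rw [← Nat.cast_succ] at h1
      have := (ZMod.natCast_inj_of_lt (by omega) (by omega)).1 h1
      omega
    rcases (hc.adj_iff _ _).1 h with h | h
    · exact key x hx y hy h
    · exact key y hy x hx h
  have hcard := hind (insert v ((Finset.range a).image g)) (by
    intro x hx y hy hxy
    simp only [Finset.coe_insert, Finset.coe_image, Set.mem_insert_iff, Set.mem_image,
      Finset.mem_coe, Finset.mem_range] at hx hy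
    rcases hx with rfl | ⟨m, hm, rfl⟩ <;> rcases hy with rfl | ⟨m', hm', rfl⟩
    · exact absurd rfl hxy
    · exact hno m' hm'
    · exact fun h => hno m hm h.symm
    · exact hgadj m hm m' hm')
  rw [Finset.card_insert_of_notMem, Finset.card_image_of_injOn hginj, Finset.card_range] at hcard
  · omega
  · simp only [Finset.mem_image, not_exists, not_and]
    exact fun m _ h => hv _ h.symm

theorem IsHole.isCenter_self (hc : G.IsHole c) (i : ZMod (2 * a + 1)) : G.IsCenter c (c i) i := by
  intro j
  rw [hc.adj_iff, hc.injective.eq_iff]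
  grind

/-- In a graph with independence number `a` and without holes of length at most `2 * a`, a vertex
either sees a whole hole of length `2 * a + 1` or has the trace of a vertex of the hole. -/
theorem IsHole.isFull_or_isCenter (ha : 2 ≤ a) (hc : G.IsHole c)
    (hind : ∀ S : Finset V, G.IsIndepSet S → S.card ≤ a)
    (hfree : ∀ k : ℕ, 4 ≤ k → k ≤ 2 * a → ¬ (cycleGraph k).IsIndContained G) (v : V) :
    G.IsFull c v ∨ ∃ i, G.IsCenter c v i := by
  classical
  obtain ⟨h1, h2, h3, h4⟩ := ZMod.small_ne_zero (n := 2 * a + 1) (by omega)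
  by_cases hv : ∃ i, v = c i
  · obtain ⟨i, rfl⟩ := hv
    exact .inr ⟨i, hc.isCenter_self i⟩
  push Not at hv
  by_cases hfull : G.IsFull c v
  · exact .inl hfull
  right
  -- Otherwise adjacency would propagate round the hole from one neighbour and `v` would be full.
  obtain ⟨i, hi, hi1⟩ : ∃ i, G.Adj v (c i) ∧ ¬ G.Adj v (c (i + 1)) := by
    by_contra! hno
    obtain ⟨m, -, hm⟩ := hc.exists_adj_alternate hind hv 0
    have hall : ∀ n : ℕ, G.Adj v (c (0 + ((2 * m + 1 : ℕ) : ZMod (2 * a + 1)) + n)) := by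
      intro n
      induction n with
      | zero => simpa using hm
      | succ n ih => simpa [add_assoc] using hno _ ih
    refine hfull fun j => ?_
    have := hall (j - (0 + ((2 * m + 1 : ℕ) : ZMod (2 * a + 1)))).val
    rwa [ZMod.natCast_zmod_val, add_sub_cancel] at this
  have hex : ∃ d : ℕ, 1 ≤ d ∧ G.Adj v (c (i + d)) :=
    ⟨2 * a + 1, by omega, by rwa [ZMod.natCast_self, add_zero]⟩
  -- `d` is the distance to the next neighbour after `c i`. The gap closes through `v` to a hole of
  -- length `d + 2`, which forces `d = 2 * a - 1`, that is `i + d = i - 2`.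
  obtain ⟨d, ⟨hd1, hd⟩, hmin⟩ : ∃ d : ℕ, (1 ≤ d ∧ G.Adj v (c (i + d))) ∧
      ∀ m : ℕ, 1 ≤ m → m < d → ¬ G.Adj v (c (i + m)) :=
    ⟨Nat.find hex, Nat.find_spec hex, fun m h1 h2 h => Nat.find_min hex h2 ⟨h1, h⟩⟩
  have hd2 : 2 ≤ d := by
    by_contra h
    have : d = 1 := by omega
    subst this
    exact hi1 (by simpa using hd)
  have hdlt : d < 2 * a := by
    by_contra h
    obtain ⟨m, hm, hm'⟩ := hc.exists_adj_alternate hind hv i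
    exact hmin _ (by omega) (by omega) hm'
  have hcyc : (cycleGraph (d + 2)).IsIndContained G := by
    refine cycleGraph_isIndContained_of_path (fun m => c (i + m)) v d hd1 ?_ ?_ ?_ ?_
    · intro x y hxy hy h
      have := (ZMod.natCast_inj_of_lt (by omega) (by omega)).1 (add_left_cancel (hc.injective h))
      omega
    · intro x y hxy hy
      rw [hc.adj_iff, add_assoc, add_assoc, add_right_inj, add_right_inj, ← Nat.cast_succ,
        ← Nat.cast_succ, ZMod.natCast_inj_of_lt (by omega) (by omega),
        ZMod.natCast_inj_of_lt (by omega) (by omega)]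
      omega
    · exact fun _ _ => hv _
    · intro m hm
      constructor
      · intro h
        by_contra! hne
        exact hmin m (by omega) (by omega) h
      · rintro (rfl | rfl)
        · simpa using hi
        · exact hd
  have hda : d = 2 * a - 1 := by
    by_contra h
    exact hfree (d + 2) (by omega) (by omega) hcyc
  have hcast : ((2 * a + 1 : ℕ) : ZMod (2 * a + 1)) = 0 := ZMod.natCast_self _
  have hd' : (d : ZMod (2 * a + 1)) = -2 := by
    have h : ((d + 2 : ℕ) : ZMod (2 * a + 1)) = 0 := by
      rw [show d + 2 = 2 * a + 1 by omega, hcast]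
    push_cast at h
    linear_combination h
  rw [hd'] at hd
  -- The only vertex still undecided; missing it would leave an induced four-cycle.
  have hmid : G.Adj v (c (i - 1)) := by
    by_contra h
    refine hfree 4 le_rfl (by omega) (cycleGraph_four_isIndContained (a := v) (b := c (i + -2))
      (c := c (i - 1)) (d := c i) hd ?_ ?_ hi.symm h ?_ (hv _) ?_)
    · rw [hc.adj_iff]; left; ring
    · rw [hc.adj_iff]; left; ring
    · rw [hc.adj_iff]; grind
    · rw [hc.injective.ne_iff]; grind
  refine ⟨i - 1, fun j => ?_⟩
  constructor
  · rintro (h | h)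
    · exact absurd h (hv j)
    · set m := (j - i).val with hm
      have hmlt : m < 2 * a + 1 := ZMod.val_lt _
      have hj : j = i + m := by rw [hm, ZMod.natCast_zmod_val]; ring
      by_cases hm0 : m = 0
      · rw [hm0] at hj
        right; right; rw [hj]; push_cast; ring
      · by_cases hm1 : m = 2 * a
        · right; left
          rw [hj, hm1]
          push_cast at hcast ⊢
          linear_combination hcast
        · by_cases hm2 : m = d
          · left
            rw [hj, hm2, hd']; ring
          · rw [hj] at h
            exact absurd h (hmin m (by omega) (by omega))
  · rintro (rfl | rfl | rfl)
    · right
      rwa [show i - 1 - 1 = i + -2 by ring]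
    · exact .inr hmid
    · right
      simpa using hi

theorem IsCenter.unique (ha : 2 ≤ a) {v : V} {i j : ZMod (2 * a + 1)} (hi : G.IsCenter c v i)
    (hj : G.IsCenter c v j) : i = j := by
  obtain ⟨h1, h2, h3, h4⟩ := ZMod.small_ne_zero (n := 2 * a + 1) (by omega)
  have e1 := (hj (i - 1)).1 ((hi (i - 1)).2 (by simp))
  have e2 := (hj i).1 ((hi i).2 (by simp))
  have e3 := (hj (i + 1)).1 ((hi (i + 1)).2 (by simp))
  grind

theorem IsCenter.ne (ha : 2 ≤ a) (hc : G.IsHole c) {v : V} {i j : ZMod (2 * a + 1)}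
    (hi : G.IsCenter c v i) (hij : i ≠ j) : v ≠ c j := by
  rintro rfl
  exact hij (hi.unique ha (hc.isCenter_self j))

theorem IsCenter.adj_iff (ha : 2 ≤ a) (hc : G.IsHole c) {v : V} {i j : ZMod (2 * a + 1)}
    (hi : G.IsCenter c v i) (hij : i ≠ j) : G.Adj v (c j) ↔ j = i - 1 ∨ j = i + 1 := by
  have := hi j
  have h := hi.ne ha hc hij
  grind

/-- Replacing a vertex of a hole by a vertex with the same trace gives a hole. -/
theorem IsHole.update (ha : 2 ≤ a) (hc : G.IsHole c) {u : V} {i : ZMod (2 * a + 1)}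
    (hu : G.IsCenter c u i) : G.IsHole (Function.update c i u) := by
  obtain ⟨h1, h2, h3, h4⟩ := ZMod.small_ne_zero (n := 2 * a + 1) (by omega)
  constructor
  · intro x y hxy
    by_cases hx : x = i <;> by_cases hy : y = i
    · rw [hx, hy]
    · subst hx
      rw [Function.update_self, Function.update_of_ne hy] at hxy
      exact absurd hxy (hu.ne ha hc (Ne.symm hy))
    · subst hy
      rw [Function.update_self, Function.update_of_ne hx] at hxy
      exact absurd hxy.symm (hu.ne ha hc (Ne.symm hx))
    · rw [Function.update_of_ne hx, Function.update_of_ne hy] at hxy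
      exact hc.injective hxy
  · intro x y
    by_cases hx : x = i <;> by_cases hy : y = i
    · subst hx; subst hy
      simp [h1]
    · subst hx
      rw [Function.update_self, Function.update_of_ne hy, hu.adj_iff ha hc (Ne.symm hy)]
      grind
    · subst hy
      rw [Function.update_self, Function.update_of_ne hx, G.adj_comm,
        hu.adj_iff ha hc (Ne.symm hx)]
      grind
    · rw [Function.update_of_ne hx, Function.update_of_ne hy]
      exact hc.adj_iff x y

/-- Two vertices adjacent to both neighbours of a vertex of the hole are adjacent. -/
theorem IsHole.adj_of_adj_of_adj (ha : 2 ≤ a) (hc : G.IsHole c)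
    (hfree : ∀ k : ℕ, 4 ≤ k → k ≤ 2 * a → ¬ (cycleGraph k).IsIndContained G) {u v : V}
    {i : ZMod (2 * a + 1)} (hu : G.Adj u (c (i - 1)) ∧ G.Adj u (c (i + 1)))
    (hv : G.Adj v (c (i - 1)) ∧ G.Adj v (c (i + 1))) (huv : u ≠ v) : G.Adj u v := by
  obtain ⟨h1, h2, h3, h4⟩ := ZMod.small_ne_zero (n := 2 * a + 1) (by omega)
  by_contra h
  refine hfree 4 le_rfl (by omega) (cycleGraph_four_isIndContained (a := u) (b := c (i - 1))
      (c := v) (d := c (i + 1)) hu.1 hv.1.symm hv.2 hu.2.symm h ?_ huv ?_)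
  · rw [hc.adj_iff]
    rintro (h | h)
    · exact h1 (by linear_combination h)
    · exact h3 (by linear_combination -h)
  · rw [hc.injective.ne_iff]
    exact fun h => h2 (by linear_combination -h)

theorem IsCenter.adj_neighbors (ha : 2 ≤ a) (hc : G.IsHole c) {u : V} {i : ZMod (2 * a + 1)}
    (hu : G.IsCenter c u i) : G.Adj u (c (i - 1)) ∧ G.Adj u (c (i + 1)) := by
  obtain ⟨h1, h2, h3, h4⟩ := ZMod.small_ne_zero (n := 2 * a + 1) (by omega)
  exact ⟨(hu.adj_iff ha hc fun h => h1 (by linear_combination h)).2 (by simp),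
    (hu.adj_iff ha hc fun h => h1 (by linear_combination -h)).2 (by simp)⟩

/-- Put `u` into the hole in place of `c i`. The trace of `v` at the other positions is unchanged
and already determines its centre `j`, so the trace on the new hole decides whether `v` sees `u`. -/
theorem IsHole.adj_iff_of_isCenter (ha : 2 ≤ a) (hc : G.IsHole c)
    (hind : ∀ S : Finset V, G.IsIndepSet S → S.card ≤ a)
    (hfree : ∀ k : ℕ, 4 ≤ k → k ≤ 2 * a → ¬ (cycleGraph k).IsIndContained G) {u v : V}
    {i j : ZMod (2 * a + 1)} (hu : G.IsCenter c u i) (hv : G.IsCenter c v j) (hij : i ≠ j) :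
    G.Adj u v ↔ j = i + 1 ∨ i = j + 1 := by
  obtain ⟨h1, h2, h3, h4⟩ := ZMod.small_ne_zero (n := 2 * a + 1) (by omega)
  have huv : v ≠ u := by
    rintro rfl
    exact hij (hu.unique ha hv)
  have hc' := hc.update ha hu
  set c' := Function.update c i u with hc'def
  have hci : c' i = u := Function.update_self ..
  have htr : ∀ l, l ≠ i → ((v = c' l ∨ G.Adj v (c' l)) ↔ (l = j - 1 ∨ l = j ∨ l = j + 1)) := by
    intro l hl
    rw [hc'def, Function.update_of_ne hl]
    exact hv l
  have hcen : G.IsCenter c' v j := by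
    rcases hc'.isFull_or_isCenter ha hind hfree v with h | ⟨j', h⟩
    · exfalso
      by_cases hj : j + 2 = i
      · rcases (htr (j - 2) fun h => h4 (by linear_combination hj - h)).1 (.inr (h _))
          with h | h | h
        · exact h1 (by linear_combination -h)
        · exact h2 (by linear_combination -h)
        · exact h3 (by linear_combination -h)
      · rcases (htr (j + 2) hj).1 (.inr (h _)) with h | h | h
        · exact h3 (by linear_combination h)
        · exact h2 (by linear_combination h)
        · exact h1 (by linear_combination h)
    -- A centre shifted by one would show at distance two from `j` on the side of the shift, or, if
    -- that position is `i`, at the neighbour of `j` on the other side.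
    · have : j' = j := by
        have t : ∀ l, l ≠ i → ((l = j' - 1 ∨ l = j' ∨ l = j' + 1) ↔
            (l = j - 1 ∨ l = j ∨ l = j + 1)) := fun l hl => (h l).symm.trans (htr l hl)
        rcases (t j hij.symm).2 (by simp) with e | e | e
        · exfalso
          by_cases hj : j + 2 = i
          · rcases (t (j - 1) fun h => h3 (by linear_combination hj - h)).2 (by simp) with h | h | h
            · exact h1 (by linear_combination e - h)
            · exact h2 (by linear_combination e - h)
            · exact h3 (by linear_combination e - h)
          · rcases (t (j + 2) hj).1 (.inr (.inr (by linear_combination e))) with h | h | h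
            · exact h3 (by linear_combination h)
            · exact h2 (by linear_combination h)
            · exact h1 (by linear_combination h)
        · exact e.symm
        · exfalso
          by_cases hj : j - 2 = i
          · rcases (t (j + 1) fun h => h3 (by linear_combination h - hj)).2 (by simp) with h | h | h
            · exact h3 (by linear_combination h - e)
            · exact h2 (by linear_combination h - e)
            · exact h1 (by linear_combination h - e)
          · rcases (t (j - 2) hj).1 (.inl (by linear_combination e)) with h | h | h
            · exact h1 (by linear_combination -h)
            · exact h2 (by linear_combination -h)
            · exact h3 (by linear_combination -h)
      rwa [this] at h
  have := hcen i
  rw [hci] at this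
  rw [G.adj_comm]
  grind

end

/-! ### Inflated odd cycles -/

/-- `G` is the join of a clique with a blow-up by cliques of the cycle of length `2 * a + 1`: the
classes of the cycle are the fibres of `p` over `0, …, 2 * a`, and the clique is the fibre over
`2 * a + 1`. -/
structure IsCycleInflation (G : SimpleGraph V) (a : ℕ) (p : V → ℕ) : Prop where
  le : ∀ v, p v ≤ 2 * a + 1
  adj_iff : ∀ u v, G.Adj u v ↔ u ≠ v ∧ (p u = 2 * a + 1 ∨ p v = 2 * a + 1 ∨ p u = p v ∨
    p v = p u + 1 ∨ p u = p v + 1 ∨ (p u = 0 ∧ p v = 2 * a) ∨ (p v = 0 ∧ p u = 2 * a))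

theorem _root_.ZMod.eq_add_one_iff_val {n : ℕ} (hn : 1 ≤ n) (i j : ZMod (n + 1)) :
    j = i + 1 ↔ (j.val = i.val + 1 ∨ (j.val = 0 ∧ i.val = n)) := by
  have hi := ZMod.val_lt i
  have hj := ZMod.val_lt j
  rw [← (ZMod.val_injective (n + 1)).eq_iff, ZMod.val_add, ZMod.val_one'' (by omega)]
  rcases eq_or_ne i.val n with h | h
  · rw [h, Nat.mod_self]; omega
  · rw [Nat.mod_eq_of_lt (by omega)]; omega

/-- The inflation structure of a graph with a hole; any class may be put at position `0`. -/
theorem IsHole.exists_isCycleInflation {a : ℕ} {c : ZMod (2 * a + 1) → V} (ha : 2 ≤ a)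
    (hc : G.IsHole c) (hind : ∀ S : Finset V, G.IsIndepSet S → S.card ≤ a)
    (hfree : ∀ k : ℕ, 4 ≤ k → k ≤ 2 * a → ¬ (cycleGraph k).IsIndContained G) :
    ∃ f : V → Option (ZMod (2 * a + 1)), ∀ i0 : ZMod (2 * a + 1),
      G.IsCycleInflation a fun v => (f v).elim (2 * a + 1) fun i => (i - i0).val := by
  classical
  have hex : ∀ v, ∃ o : Option (ZMod (2 * a + 1)), o.elim (G.IsFull c v) (G.IsCenter c v) := by
    intro v
    rcases hc.isFull_or_isCenter ha hind hfree v with h | ⟨i, h⟩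
    · exact ⟨none, h⟩
    · exact ⟨some i, h⟩
  choose f hf using hex
  refine ⟨f, fun i0 => ⟨fun v => ?_, fun u v => ?_⟩⟩
  · cases f v with
    | none => exact le_rfl
    | some i => exact (ZMod.val_lt (i - i0)).le
  · have hu := hf u
    have hv := hf v
    cases hfu : f u with
    | none =>
      rw [hfu] at hu
      simp only [Option.elim_none, true_or, and_true]
      refine ⟨fun h => h.ne, fun h => ?_⟩
      cases hfv : f v with
      | none =>
        rw [hfv] at hv
        exact hc.adj_of_adj_of_adj (i := 0) ha hfree ⟨hu _, hu _⟩ ⟨hv _, hv _⟩ h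
      | some j =>
        rw [hfv] at hv
        exact hc.adj_of_adj_of_adj ha hfree ⟨hu _, hu _⟩ (IsCenter.adj_neighbors ha hc hv) h
    | some i =>
      rw [hfu] at hu
      cases hfv : f v with
      | none =>
        rw [hfv] at hv
        simp only [Option.elim_none, true_or, or_true, and_true]
        exact ⟨fun h => h.ne,
          hc.adj_of_adj_of_adj ha hfree (IsCenter.adj_neighbors ha hc hu) ⟨hv _, hv _⟩⟩
      | some j =>
        rw [hfv] at hv
        simp only [Option.elim_some]
        have l1 := ZMod.val_lt (i - i0)
        have l2 := ZMod.val_lt (j - i0)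
        by_cases hij : i = j
        · subst hij
          simp only [true_or, or_true, and_true]
          exact ⟨fun h => h.ne, hc.adj_of_adj_of_adj ha hfree
            (IsCenter.adj_neighbors ha hc hu) (IsCenter.adj_neighbors ha hc hv)⟩
        · have hne : u ≠ v := by
            rintro rfl
            exact hij (IsCenter.unique ha hu hv)
          have hval : (i - i0).val ≠ (j - i0).val := fun h =>
            hij (sub_left_injective (ZMod.val_injective _ h))
          have e1 := ZMod.eq_add_one_iff_val (n := 2 * a) (by omega) (i - i0) (j - i0)
          have e2 := ZMod.eq_add_one_iff_val (n := 2 * a) (by omega) (j - i0) (i - i0)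
          rw [show j - i0 = i - i0 + 1 ↔ j = i + 1 by grind] at e1
          rw [show i - i0 = j - i0 + 1 ↔ i = j + 1 by grind] at e2
          rw [hc.adj_iff_of_isCenter ha hind hfree hu hv hij, e1, e2]
          simp only [ne_eq, hne, not_false_eq_true, true_and]
          omega

/-- Every hole in a graph of independence number `a` without holes of length at most `2 * a` has
length `2 * a + 1`. -/
theorem exists_isHole_of_isIndContained {a k : ℕ} (ha : 2 ≤ a)
    (hind : ∀ S : Finset V, G.IsIndepSet S → S.card ≤ a)
    (hfree : ∀ k : ℕ, 4 ≤ k → k ≤ 2 * a → ¬ (cycleGraph k).IsIndContained G) (hk : 4 ≤ k)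
    (h : (cycleGraph k).IsIndContained G) : ∃ c : ZMod (2 * a + 1) → V, G.IsHole c := by
  classical
  have hk1 : 2 * a < k := by
    by_contra hlt
    exact hfree k hk (by omega) h
  obtain ⟨φ⟩ := h
  have hk2 : k = 2 * a + 1 := by
    by_contra hne
    -- The vertices `0, 2, …, 2 * a` are independent once `k ≥ 2 * a + 2`, since `2 * a` is then not
    -- the last vertex.
    have hcard := hind ((Finset.univ : Finset (Fin (a + 1))).map
      ⟨fun m => φ ⟨2 * m.val, by omega⟩, fun x y h => by
        have := φ.injective h
        simp only [Fin.mk.injEq] at this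
        omega⟩) (by
      intro x hx y hy hxy
      simp only [Finset.coe_map, Finset.coe_univ, Set.image_univ,
        Set.mem_range] at hx hy
      obtain ⟨m, rfl⟩ := hx
      obtain ⟨m', rfl⟩ := hy
      change ¬ G.Adj (φ _) (φ _)
      rw [φ.map_adj_iff, cycleGraph_adj_iff_val (by omega)]
      dsimp only
      omega)
    simp at hcard
  subst hk2
  refine ⟨fun i => φ ⟨i.val, ZMod.val_lt i⟩, fun i j hij => ?_, fun i j => ?_⟩
  · have := φ.injective hij
    exact ZMod.val_injective _ (by simpa using this)
  · rw [φ.map_adj_iff, cycleGraph_adj_iff_val (by omega),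
      ZMod.eq_add_one_iff_val (n := 2 * a) (by omega),
      ZMod.eq_add_one_iff_val (n := 2 * a) (by omega)]
    dsimp only
    omega

theorem IsClique.containsImmersion_of_le {S : Finset V} (hS : G.IsClique S) {t : ℕ}
    (ht : t ≤ S.card) : G.ContainsImmersion (completeGraph (Fin t)) := by
  obtain ⟨T, hTS, rfl⟩ := Finset.exists_subset_card_eq ht
  exact IsClique.containsImmersion (hS.subset (by exact_mod_cast hTS))

/-- The vertices of each fibre of `p` can be numbered from `0` on. -/
theorem _root_.Finset.exists_fiber_rank [Fintype V] (p : V → ℕ) : ∃ r : V → ℕ,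
    (∀ v, r v < (Finset.univ.filter (p · = p v)).card) ∧
    (∀ u v, p u = p v → r u = r v → u = v) ∧
    ∀ j, ∀ m < (Finset.univ.filter (p · = j)).card, ∃ v, p v = j ∧ r v = m := by
  classical
  refine ⟨fun v => ((Finset.univ.filter (p · = p v)).equivFin ⟨v, by simp⟩).val, ?_, ?_, ?_⟩
  · exact fun v => Fin.is_lt _
  · have key : ∀ (j j' : ℕ) (u v : V) (hu : p u = j) (hv : p v = j'), j = j' →
        ((Finset.univ.filter (p · = j)).equivFin ⟨u, by simpa using hu⟩).val =
        ((Finset.univ.filter (p · = j')).equivFin ⟨v, by simpa using hv⟩).val → u = v := by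
      rintro j _ u v hu hv rfl h
      simpa using (Finset.univ.filter (p · = j)).equivFin.injective (Fin.ext h)
    exact fun u v huv h => key (p u) (p v) u v rfl rfl huv h
  · intro j m hm
    obtain ⟨⟨v, hv⟩, h⟩ := (Finset.univ.filter (p · = j)).equivFin.surjective ⟨m, hm⟩
    have hv' : p v = j := by simpa using hv
    subst hv'
    exact ⟨v, rfl, congrArg Fin.val h⟩

/-! ### Colouring an inflated odd cycle -/

/-- The colour of the vertex number `r` of class `j` of an inflated odd cycle. Odd classes and
class `0` use low colours, the other even ones use high colours; outside the classes `1, …, i` the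
colours `0, …, n₀ + n₁ - 1` are permuted so that the colours of the classes `0` and `1` are
disjoint. -/
def inflationColor (n₀ n₁ c i j r : ℕ) : ℕ :=
  let b := if j = 0 ∨ j % 2 = 1 then r else c - 1 - r
  if 1 ≤ j ∧ j ≤ i then b else if b < n₀ then b + n₁ else if b < n₀ + n₁ then b - n₀ else b

theorem inflationColor_lt {n₀ n₁ c i j r : ℕ} (h : n₀ + n₁ ≤ c) (hr : r < c) :
    inflationColor n₀ n₁ c i j r < c := by
  unfold inflationColor
  dsimp only
  split_ifs <;> omega

theorem inflationColor_injOn {n₀ n₁ c i j r r' : ℕ} (hr : r < c) (hr' : r' < c)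
    (h : inflationColor n₀ n₁ c i j r = inflationColor n₀ n₁ c i j r') : r = r' := by
  unfold inflationColor at h
  dsimp only at h
  split_ifs at h <;> omega

theorem inflationColor_zero_ne_one {n₀ n₁ c i r r' : ℕ} (hi : 2 ≤ i) (hr : r < n₀) (hr' : r' < n₁) :
    inflationColor n₀ n₁ c i 0 r ≠ inflationColor n₀ n₁ c i 1 r' := by
  unfold inflationColor
  dsimp only
  split_ifs <;> omega

/-- Consecutive classes use opposite ends of the palette, and sizes adding up to at most `c` do not
overlap. At the border `j = i` the permutation sets in, but class `i` is even and uses only colours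
`≥ c - ni ≥ n₀ + n₁`, which it fixes. -/
theorem inflationColor_succ_ne {n₀ n₁ ni c i j r r' x y : ℕ} (hi2 : i % 2 = 0)
    (hni : n₀ + n₁ + ni ≤ c) (hj : 1 ≤ j) (hr : r < x) (hr' : r' < y) (hxy : x + y ≤ c)
    (hx : j = i → x = ni) :
    inflationColor n₀ n₁ c i j r ≠ inflationColor n₀ n₁ c i (j + 1) r' := by
  unfold inflationColor
  dsimp only
  rcases Nat.mod_two_eq_zero_or_one j with h | h
  · rw [if_neg (show ¬ (j = 0 ∨ j % 2 = 1) by omega),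
      if_pos (show j + 1 = 0 ∨ (j + 1) % 2 = 1 by omega)]
    split_ifs <;> omega
  · rw [if_pos (show j = 0 ∨ j % 2 = 1 by omega),
      if_neg (show ¬ (j + 1 = 0 ∨ (j + 1) % 2 = 1) by omega)]
    split_ifs <;> omega

theorem inflationColor_zero_ne_last {n₀ n₁ ni c i a r r' y : ℕ}
    (hni : n₀ + n₁ + ni ≤ c) (hi : i ≤ 2 * a) (ha : 1 ≤ a) (hr : r < n₀) (hr' : r' < y)
    (hxy : n₀ + y ≤ c) (hy : 2 * a = i → y = ni) :
    inflationColor n₀ n₁ c i 0 r ≠ inflationColor n₀ n₁ c i (2 * a) r' := by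
  unfold inflationColor
  dsimp only
  split_ifs <;> omega

/-- The common clique gets its own colours, from `c` on; the cycle classes use those below `c`. -/
theorem IsCycleInflation.colorable {a : ℕ} {p : V → ℕ} (H : G.IsCycleInflation a p) (ha : 2 ≤ a)
    {r : V → ℕ} {n : ℕ → ℕ} (hr : ∀ v, r v < n (p v))
    (hinj : ∀ u v, p u = p v → r u = r v → u = v) {c i : ℕ} (hi2 : i % 2 = 0) (hi : 2 ≤ i)
    (hia : i ≤ 2 * a) (hpair : ∀ j < 2 * a, n j + n (j + 1) ≤ c) (hlast : n 0 + n (2 * a) ≤ c)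
    (hni : n 0 + n 1 + n i ≤ c) : G.Colorable (n (2 * a + 1) + c) := by
  have hle : ∀ v, p v ≠ 2 * a + 1 → r v < c := by
    intro v hv
    have h1 := H.le v
    have h2 := hr v
    rcases Nat.lt_or_ge (p v) (2 * a) with h | h
    · have := hpair _ h; omega
    · have : p v = 2 * a := by omega
      rw [this] at h2; omega
  let col : V → ℕ := fun v => if p v = 2 * a + 1 then c + r v else
    inflationColor (n 0) (n 1) c i (p v) (r v)
  have hfull : ∀ v, p v = 2 * a + 1 → col v = c + r v := fun v h => if_pos h
  have hcyc : ∀ v, p v ≠ 2 * a + 1 → col v = inflationColor (n 0) (n 1) c i (p v) (r v) :=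
    fun v h => if_neg h
  have hcyclt : ∀ v, p v ≠ 2 * a + 1 → col v < c := by
    intro v h
    rw [hcyc v h]
    exact inflationColor_lt (by omega) (hle v h)
  have hsucc : ∀ u v, p u ≠ 2 * a + 1 → p v ≠ 2 * a + 1 → p v = p u + 1 → col u ≠ col v := by
    intro u v hu hv huv
    have h1 := H.le v
    have h2 := hr u
    have h3 := hr v
    rw [hcyc u hu, hcyc v hv]
    rcases Nat.eq_zero_or_pos (p u) with h0 | h0
    · have h4 : p v = 1 := by omega
      rw [h0] at h2 ⊢
      rw [h4] at h3 ⊢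
      exact inflationColor_zero_ne_one hi h2 h3
    · rw [huv] at h3 ⊢
      exact inflationColor_succ_ne hi2 hni h0 h2 h3 (hpair _ (by omega)) (fun h => by rw [h])
  have hwrap : ∀ u v, p u = 0 → p v = 2 * a → col u ≠ col v := by
    intro u v hu hv
    have h2 := hr u
    have h3 := hr v
    rw [hcyc u (by omega), hcyc v (by omega)]
    rw [hu] at h2 ⊢
    rw [hv] at h3 ⊢
    exact inflationColor_zero_ne_last hni hia (by omega) h2 h3 hlast (fun h => by rw [h])
  have hlt : ∀ v, col v < n (2 * a + 1) + c := by
    intro v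
    by_cases h : p v = 2 * a + 1
    · have := hr v
      rw [hfull v h]
      rw [h] at this
      omega
    · have := hcyclt v h
      omega
  refine ⟨Coloring.mk (fun v => (⟨col v, hlt v⟩ : Fin _)) ?_⟩
  intro u v huv h
  replace h : col u = col v := by simpa using h
  obtain ⟨hne, hp⟩ := (H.adj_iff u v).1 huv
  by_cases hu : p u = 2 * a + 1 <;> by_cases hv : p v = 2 * a + 1
  · rw [hfull u hu, hfull v hv] at h
    exact hne (hinj u v (hu.trans hv.symm) (by omega))
  · have := hcyclt v hv
    rw [hfull u hu] at h
    omega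
  · have := hcyclt u hu
    rw [hfull v hv] at h
    omega
  · rcases hp with hp | hp | hp | hp | hp | hp | hp
    · exact hu hp
    · exact hv hp
    · rw [hcyc u hu, hcyc v hv, hp] at h
      exact hne (hinj u v hp (inflationColor_injOn (hle u hu) (hle v hv) h))
    · exact hsucc u v hu hv hp h
    · exact hsucc v u hv hu hp h.symm
    · exact hwrap u v hp.1 hp.2 h
    · exact hwrap v u hp.1 hp.2 h.symm

theorem IsCycleInflation.isClique [Fintype V] {a : ℕ} {p : V → ℕ} (H : G.IsCycleInflation a p)
    {j j' : ℕ} (hj : j' = j + 1 ∨ (j = 0 ∧ j' = 2 * a)) :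
    G.IsClique (Finset.univ.filter fun v => p v = 2 * a + 1 ∨ p v = j ∨ p v = j') := by
  intro u hu v hv huv
  simp only [Finset.coe_filter, Finset.mem_univ, true_and, Set.mem_ofPred_eq] at hu hv
  exact (H.adj_iff u v).2 ⟨huv, by omega⟩

theorem _root_.Finset.card_filter_three_fibers [Fintype V] (p : V → ℕ) {x y z : ℕ} (hxy : x ≠ y)
    (hxz : x ≠ z) (hyz : y ≠ z) :
    (Finset.univ.filter fun v => p v = x ∨ p v = y ∨ p v = z).card =
      (Finset.univ.filter (p · = x)).card + (Finset.univ.filter (p · = y)).card +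
        (Finset.univ.filter (p · = z)).card := by
  classical
  rw [Finset.filter_or, Finset.card_union_of_disjoint, Finset.filter_or,
    Finset.card_union_of_disjoint, add_assoc]
  · exact Finset.disjoint_filter.2 fun v _ h => by omega
  · exact Finset.disjoint_filter.2 fun v _ h => by omega

/-! ### Routing and the immersion in an inflated odd cycle -/

/-- The routing in an inflated odd cycle. The branch vertices are the common clique, the classes
`0` and `1`, and `k` vertices of class `2`; a vertex of class `0` and one of class `2` are joined
the long way round the cycle, through vertices whose numbers alternate between those of the two
ends. -/
theorem IsCycleInflation.containsImmersion_of_routing [Fintype V] [Nonempty V] {a : ℕ} {p : V → ℕ}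
    (H : G.IsCycleInflation a p) (ha : 2 ≤ a) {r : V → ℕ} {n : ℕ → ℕ} (hr : ∀ v, r v < n (p v))
    (hinj : ∀ u v, p u = p v → r u = r v → u = v)
    (hsurj : ∀ j, ∀ m < n j, ∃ v, p v = j ∧ r v = m) {k : ℕ}
    (hmin : ∀ j ≤ 2 * a, n 0 ≤ n j) (hk : ∀ i, i % 2 = 0 → 2 ≤ i → i ≤ 2 * a → k ≤ n i) :
    G.ContainsImmersion (completeGraph (Fin (Finset.univ.filter fun v =>
      (p v = 2 * a + 1 ∨ p v = 0 ∨ p v = 1) ∨ (p v = 2 ∧ r v < k)).card)) := by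
  classical
  set S := Finset.univ.filter fun v =>
      (p v = 2 * a + 1 ∨ p v = 0 ∨ p v = 1) ∨ (p v = 2 ∧ r v < k) with hS
  have hmem : ∀ v, v ∈ S ↔ (p v = 2 * a + 1 ∨ p v = 0 ∨ p v = 1) ∨ (p v = 2 ∧ r v < k) := by
    intro v; simp [hS]
  have hvert : ∀ j m, ∃ v, m < n j → p v = j ∧ r v = m := by
    intro j m
    by_cases h : m < n j
    · obtain ⟨v, hv⟩ := hsurj j m h
      exact ⟨v, fun _ => hv⟩
    · exact ⟨Classical.arbitrary V, fun h' => absurd h' h⟩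
  choose vert hvert using hvert
  -- Class `0` counts as level `2 * a + 1`, so that a route climbs from level `2` one level at a
  -- time.
  let lev : V → ℕ := fun v => if p v = 0 then 2 * a + 1 else p v
  -- Even levels carry the number of `y`, odd ones that of `x`; as `2 * a + 1` is odd, the route
  -- ends at `x` itself.
  let q : V → V → ℕ → V := fun x y m =>
    vert (if m = 2 * a + 1 then 0 else m) (if m % 2 = 0 then r y else r x)
  have hq : ∀ x y, x ∈ S → y ∈ S → p x = 0 → p y = 2 → ∀ m, 2 ≤ m → m ≤ 2 * a + 1 →
      p (q x y m) = (if m = 2 * a + 1 then 0 else m) ∧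
      r (q x y m) = (if m % 2 = 0 then r y else r x) := by
    intro x y hx hy hpx hpy m hm1 hm2
    apply hvert
    have h1 := hr x
    rw [hpx] at h1
    have h2 := (hmem y).1 hy
    by_cases hm : m = 2 * a + 1
    · rw [if_pos hm, if_neg (by omega)]
      exact h1
    · rw [if_neg hm]
      split_ifs with h
      · have := hk m h hm1 (by omega)
        omega
      · have := hmin m (by omega)
        omega
  have hlev : ∀ x y, x ∈ S → y ∈ S → p x = 0 → p y = 2 → ∀ m, 2 ≤ m → m ≤ 2 * a + 1 →
      lev (q x y m) = m := by
    intro x y hx hy hpx hpy m hm1 hm2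
    have := (hq x y hx hy hpx hpy m hm1 hm2).1
    simp only [lev, this]
    split_ifs <;> omega
  have hqS : ∀ x y, x ∈ S → y ∈ S → p x = 0 → p y = 2 → ∀ m, 3 ≤ m → m ≤ 2 * a →
      q x y m ∉ S := by
    intro x y hx hy hpx hpy m hm1 hm2
    have := (hq x y hx hy hpx hpy m (by omega) (by omega)).1
    rw [if_neg (by omega)] at this
    rw [hmem]
    omega
  have hq2 : ∀ x y, x ∈ S → y ∈ S → p x = 0 → p y = 2 → q x y 2 = y := by
    intro x y hx hy hpx hpy
    have := hq x y hx hy hpx hpy 2 le_rfl (by omega)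
    rw [if_neg (by omega), if_pos (by omega)] at this
    exact hinj _ _ (this.1.trans hpy.symm) this.2
  have hqlast : ∀ x y, x ∈ S → y ∈ S → p x = 0 → p y = 2 → q x y (2 * a + 1) = x := by
    intro x y hx hy hpx hpy
    have := hq x y hx hy hpx hpy (2 * a + 1) (by omega) le_rfl
    rw [if_pos rfl, if_neg (by omega)] at this
    exact hinj _ _ (this.1.trans hpx.symm) this.2
  let E : V → V → Set (Sym2 V) := fun x y =>
    {e | p x = 0 ∧ p y = 2 ∧ ∃ m, 2 ≤ m ∧ m ≤ 2 * a ∧ e = s(q x y m, q x y (m + 1))}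
  -- An edge of a route has one end on an even and one on an odd level, so it reveals both `r x` and
  -- `r y`, hence `x` and `y`.
  have hE : ∀ x ∈ S, ∀ y ∈ S, ∀ x' ∈ S, ∀ y' ∈ S, ∀ e, e ∈ E x y → e ∈ E x' y' →
      x = x' ∧ y = y' := by
    rintro x hx y hy x' hx' y' hy' e ⟨h1, h2, m, hm1, hm2, rfl⟩ ⟨h1', h2', m', hm1', hm2', he⟩
    have l1 := hlev x y hx hy h1 h2 m hm1 (by omega)
    have l2 := hlev x y hx hy h1 h2 (m + 1) (by omega) (by omega)
    have l1' := hlev x' y' hx' hy' h1' h2' m' hm1' (by omega)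
    have l2' := hlev x' y' hx' hy' h1' h2' (m' + 1) (by omega) (by omega)
    rcases Sym2.eq_iff.1 he with ⟨e1, e2⟩ | ⟨e1, e2⟩
    · have hmm : m = m' := by rw [← l1, ← l1', e1]
      subst hmm
      have r1 := (hq x y hx hy h1 h2 m hm1 (by omega)).2
      have r2 := (hq x y hx hy h1 h2 (m + 1) (by omega) (by omega)).2
      have r1' := (hq x' y' hx' hy' h1' h2' m hm1 (by omega)).2
      have r2' := (hq x' y' hx' hy' h1' h2' (m + 1) (by omega) (by omega)).2
      rw [e1, r1'] at r1
      rw [e2, r2'] at r2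
      have hrr : r x = r x' ∧ r y = r y' := by
        rcases Nat.mod_two_eq_zero_or_one m with h | h
        · rw [if_pos h, if_pos h] at r1
          rw [if_neg (by omega), if_neg (by omega)] at r2
          exact ⟨r2.symm, r1.symm⟩
        · rw [if_neg (by omega), if_neg (by omega)] at r1
          rw [if_pos (by omega), if_pos (by omega)] at r2
          exact ⟨r1.symm, r2.symm⟩
      exact ⟨hinj _ _ (h1.trans h1'.symm) hrr.1, hinj _ _ (h2.trans h2'.symm) hrr.2⟩
    · rw [e1, l2'] at l1
      rw [e2, l1'] at l2
      omega
  -- Each route edge has an end on a level from `3` to `2 * a`, outside `S`, so routes avoid the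
  -- direct edges between branch vertices.
  have hES : ∀ x ∈ S, ∀ y ∈ S, ∀ x' ∈ S, ∀ y' ∈ S, s(x', y') ∉ E x y := by
    rintro x hx y hy x' hx' y' hy' ⟨h1, h2, m, hm1, hm2, he⟩
    have hboth : ∀ z ∈ s(q x y m, q x y (m + 1)), z ∈ S := by
      rw [← he]
      intro z hz
      rcases Sym2.mem_iff.1 hz with rfl | rfl <;> assumption
    rcases Nat.lt_or_ge m 3 with h | h
    · exact hqS x y hx hy h1 h2 (m + 1) (by omega) (by omega) (hboth _ (by simp))
    · exact hqS x y hx hy h1 h2 m h hm2 (hboth _ (by simp))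
  have hroute : ∀ x ∈ S, ∀ y ∈ S, p x = 0 → p y = 2 → ∃ w : G.Walk x y,
      (∀ e ∈ w.edges, e ∈ E x y) ∧ ∀ z ∈ w.support, z ∈ S → z = x ∨ z = y := by
    intro x hx y hy hpx hpy
    obtain ⟨w, hw1, hw2⟩ := exists_walk_of_adj_succ (G := G) (q x y) 2 (2 * a - 1) (by
      intro m hm1 hm2
      have l1 := hlev x y hx hy hpx hpy m hm1 (by omega)
      have l2 := hlev x y hx hy hpx hpy (m + 1) (by omega) (by omega)
      have p1 := (hq x y hx hy hpx hpy m hm1 (by omega)).1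
      have p2 := (hq x y hx hy hpx hpy (m + 1) (by omega) (by omega)).1
      refine (H.adj_iff _ _).2 ⟨fun h => ?_, ?_⟩
      · rw [h, l2] at l1
        omega
      · rw [p1, p2]
        split_ifs <;> omega)
    have hend : q x y (2 + (2 * a - 1)) = x := by
      rw [show 2 + (2 * a - 1) = 2 * a + 1 by omega]
      exact hqlast x y hx hy hpx hpy
    refine ⟨(w.copy (hq2 x y hx hy hpx hpy) hend).reverse, ?_, ?_⟩
    · intro e he
      simp only [Walk.edges_reverse, List.mem_reverse, Walk.edges_copy] at he
      obtain ⟨m, h1, h2, rfl⟩ := hw1 e he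
      exact ⟨hpx, hpy, m, h1, by omega, rfl⟩
    · intro z hz hzS
      simp only [Walk.support_reverse, List.mem_reverse, Walk.support_copy] at hz
      obtain ⟨m, h1, h2, rfl⟩ := hw2 z hz
      by_cases hm2 : m = 2
      · right
        rw [hm2]
        exact hq2 x y hx hy hpx hpy
      · by_cases hml : m = 2 * a + 1
        · left
          rw [hml]
          exact hqlast x y hx hy hpx hpy
        · exact absurd hzS (hqS x y hx hy hpx hpy m (by omega) (by omega))
  let D : V → V → Set (Sym2 V) := fun x y =>
    {e | ¬ (p x = 0 ∧ p y = 2) ∧ ¬ (p y = 0 ∧ p x = 2) ∧ e = s(x, y)}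
  have hDsymm : ∀ x y, D x y = D y x := by
    intro x y
    ext e
    simp only [D, Set.mem_ofPred_eq, Sym2.eq_swap (a := x) (b := y)]
    tauto
  refine containsImmersion_completeGraph_of_walks S (fun x y => E x y ∪ E y x ∪ D x y) ?_ ?_ ?_
  · intro x y
    rw [Set.union_comm (E x y), hDsymm]
  · intro x hx y hy hxy
    by_cases h1 : p x = 0 ∧ p y = 2
    · obtain ⟨w, hw1, hw2⟩ := hroute x hx y hy h1.1 h1.2
      exact ⟨w, fun e he => .inl (.inl (hw1 e he)), hw2⟩
    by_cases h2 : p y = 0 ∧ p x = 2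
    · obtain ⟨w, hw1, hw2⟩ := hroute y hy x hx h2.1 h2.2
      refine ⟨w.reverse, fun e he => .inl (.inr (hw1 e (by simpa using he))), fun z hz hzS => ?_⟩
      exact (hw2 z (by simpa using hz) hzS).symm
    · have hadj : G.Adj x y := by
        have hx' := (hmem x).1 hx
        have hy' := (hmem y).1 hy
        exact (H.adj_iff x y).2 ⟨hxy, by omega⟩
      refine ⟨hadj.toWalk, fun e he => .inr ⟨h1, h2, by simpa using he⟩, by simp⟩
  · rintro x hx y hy x' hx' y' hy' hxy hxy' e ((he | he) | ⟨-, -, rfl⟩) ((he' | he') | ⟨-, -, he'⟩)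
    · obtain ⟨rfl, rfl⟩ := hE _ hx _ hy _ hx' _ hy' e he he'
      rfl
    · obtain ⟨rfl, rfl⟩ := hE _ hx _ hy _ hy' _ hx' e he he'
      exact Sym2.eq_swap
    · subst he'
      exact absurd he (hES _ hx _ hy _ hx' _ hy')
    · obtain ⟨rfl, rfl⟩ := hE _ hy _ hx _ hx' _ hy' e he he'
      exact Sym2.eq_swap
    · obtain ⟨rfl, rfl⟩ := hE _ hy _ hx _ hy' _ hx' e he he'
      rfl
    · subst he'
      exact absurd he (hES _ hy _ hx _ hx' _ hy')
    · exact absurd he' (hES _ hx' _ hy' _ hx _ hy)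
    · exact absurd he' (hES _ hy' _ hx' _ hx _ hy)
    · exact he'

theorem IsCycleInflation.containsImmersion [Fintype V] {a : ℕ} {p : V → ℕ}
    (H : G.IsCycleInflation a p) (ha : 2 ≤ a)
    (hmin : ∀ j ≤ 2 * a, (Finset.univ.filter (p · = 0)).card ≤ (Finset.univ.filter (p · = j)).card)
    {t : ℕ} (ht : ∀ m < t, ¬ G.Colorable m) :
    G.ContainsImmersion (completeGraph (Fin t)) := by
  classical
  rcases isEmpty_or_nonempty V with hV | hV
  · have ht0 : t = 0 := by
      by_contra h
      exact ht 0 (by omega) (.of_isEmpty 0)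
    exact IsClique.containsImmersion_of_le (S := ∅) (by simp) (by simp [ht0])
  obtain ⟨r, hr, hinj, hsurj⟩ := Finset.exists_fiber_rank p
  set n : ℕ → ℕ := fun j => (Finset.univ.filter (p · = j)).card with hn
  have hclique : ∀ j j', (j' = j + 1 ∨ (j = 0 ∧ j' = 2 * a)) → j < 2 * a → j' ≤ 2 * a →
      t ≤ n (2 * a + 1) + n j + n j' → G.ContainsImmersion (completeGraph (Fin t)) := by
    intro j j' hj h1 h2 hle
    refine IsClique.containsImmersion_of_le (H.isClique hj) ?_
    rw [Finset.card_filter_three_fibers p (by omega) (by omega) (by omega)]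
    exact hle
  by_cases hpair : ∃ j < 2 * a, t ≤ n (2 * a + 1) + n j + n (j + 1)
  · obtain ⟨j, hj, h⟩ := hpair
    exact hclique j (j + 1) (.inl rfl) hj (by omega) h
  push Not at hpair
  by_cases hlast : t ≤ n (2 * a + 1) + n 0 + n (2 * a)
  · exact hclique 0 (2 * a) (.inr ⟨rfl, rfl⟩) (by omega) le_rfl hlast
  push Not at hlast
  have h01 := hpair 0 (by omega)
  rw [zero_add] at h01
  have hk : ∀ i, i % 2 = 0 → 2 ≤ i → i ≤ 2 * a → t - n (2 * a + 1) - n 0 - n 1 ≤ n i := by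
    intro i hi2 hi hia
    by_contra hlt
    -- The number of colours is `t - 1`: `hlt` makes the truncated subtraction exact.
    refine ht (n (2 * a + 1) + (t - 1 - n (2 * a + 1))) (by omega)
      (H.colorable ha (n := n) hr hinj hi2 hi hia ?_ (by omega) (by omega))
    intro j hj
    have := hpair j hj
    omega
  have himm := H.containsImmersion_of_routing ha (n := n) hr hinj hsurj hmin hk
  convert himm
  rw [Finset.filter_or, Finset.card_union_of_disjoint,
    Finset.card_filter_three_fibers p (by omega) (by omega) (by omega)]
  · have hcard : (Finset.univ.filter fun v =>
        p v = 2 ∧ r v < t - n (2 * a + 1) - n 0 - n 1).card = t - n (2 * a + 1) - n 0 - n 1 := by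
      rw [← Finset.card_range (t - n (2 * a + 1) - n 0 - n 1)]
      refine Finset.card_bij (fun v _ => r v) ?_ ?_ ?_
      · intro v hv
        simp only [Finset.mem_filter, Finset.mem_univ, true_and] at hv
        simpa using hv.2
      · intro u hu v hv huv
        simp only [Finset.mem_filter, Finset.mem_univ, true_and] at hu hv
        exact hinj u v (hu.1.trans hv.1.symm) huv
      · intro m hm
        rw [Finset.mem_range] at hm
        obtain ⟨v, hv1, hv2⟩ := hsurj 2 m (lt_of_lt_of_le hm (hk 2 rfl le_rfl (by omega)))
        exact ⟨v, by simp [hv1, hv2, hm], hv2⟩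
    rw [hcard]
    change t = n (2 * a + 1) + n 0 + n 1 + _
    omega
  · exact Finset.disjoint_filter.2 fun v _ h => by omega

/-- A graph with a hole, independence number `a`, and no holes of length at most `2 * a`. -/
theorem IsHole.containsImmersion [Finite V] {a : ℕ} {c : ZMod (2 * a + 1) → V} (ha : 2 ≤ a)
    (hc : G.IsHole c) (hind : ∀ S : Finset V, G.IsIndepSet S → S.card ≤ a)
    (hfree : ∀ k : ℕ, 4 ≤ k → k ≤ 2 * a → ¬ (cycleGraph k).IsIndContained G) {t : ℕ}
    (ht : ∀ m < t, ¬ G.Colorable m) : G.ContainsImmersion (completeGraph (Fin t)) := by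
  classical
  have := Fintype.ofFinite V
  obtain ⟨f, hf⟩ := hc.exists_isCycleInflation ha hind hfree
  -- The smallest class is rotated to position `0`, so that every odd class has room for the numbers
  -- of class `0`.
  obtain ⟨i0, -, hi0⟩ := Finset.exists_min_image Finset.univ
    (fun i : ZMod (2 * a + 1) => (Finset.univ.filter (f · = some i)).card) Finset.univ_nonempty
  have hfib : ∀ j ≤ 2 * a, (Finset.univ.filter fun v =>
      ((f v).elim (2 * a + 1) fun i => (i - i0).val) = j) =
      Finset.univ.filter (f · = some (i0 + (j : ZMod (2 * a + 1)))) := by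
    intro j hj
    ext v
    simp only [Finset.mem_filter, Finset.mem_univ, true_and]
    cases f v with
    | none => simp; omega
    | some i =>
      simp only [Option.elim_some, Option.some.injEq]
      rw [← sub_eq_iff_eq_add', ← (ZMod.val_injective (2 * a + 1)).eq_iff,
        ZMod.val_natCast_of_lt (by omega)]
  refine (hf i0).containsImmersion ha (fun j hj => ?_) ht
  rw [hfib j hj, hfib 0 (by omega), Nat.cast_zero, add_zero]
  exact hi0 _ (Finset.mem_univ _)

end SimpleGraph

theorem theorem3 {V : Type*} [Finite V] (G : SimpleGraph V)
    (hα : 2 ≤ G.indepNum)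
    (hfree : ∀ k : ℕ, 4 ≤ k → k ≤ 2 * G.indepNum →
      ¬ (SimpleGraph.cycleGraph k).IsIndContained G) :
    G.SatisfiesLescureMeyniel := by
  obtain ⟨t, ht⟩ := ENat.ne_top_iff_exists.1
    (SimpleGraph.chromaticNumber_ne_top_iff_exists.2 ⟨_, G.colorable_chromaticNumber_of_fintype⟩)
  refine ⟨t, ht.symm, ?_⟩
  by_cases hhole : ∃ k, 4 ≤ k ∧ (SimpleGraph.cycleGraph k).IsIndContained G
  · obtain ⟨k, hk, h⟩ := hhole
    have hind : ∀ S : Finset V, G.IsIndepSet S → S.card ≤ G.indepNum :=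
      fun S hS => hS.card_le_indepNum
    obtain ⟨c, hc⟩ := SimpleGraph.exists_isHole_of_isIndContained hα hind hfree hk h
    refine hc.containsImmersion hα hind hfree fun m hm hcol => ?_
    have := hcol.chromaticNumber_le
    rw [← ht, Nat.cast_le] at this
    omega
  · push Not at hhole
    have := (SimpleGraph.colorable_cliqueNum_of_no_hole hhole).chromaticNumber_le
    rw [← ht, Nat.cast_le] at this
    obtain ⟨S, hS⟩ := G.exists_isNClique_cliqueNum
    exact hS.isClique.containsImmersion_of_le (hS.card_eq ▸ this)
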